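/- A finite set of points in the plane $\mathbb R^2$ is generic if no three of its points are collinear. For two points $P,Q$ of a finite generic set $\mathcal P$, let $n(P,Q)$ be the number of lines through two distinct points of $\mathcal P\setminus\{P,Q\}$ that separate $P$ and $Q$ (i.e. $P$ and $Q$ lie in different connected components of the complement of the line). A rectilinear drawing $R(G)$ of a finite graph $G=(V,E)$ is a generic set of points of $\mathbb R^2$ in bijection with $V$; its crossing number is $n(R(G))=\sum_{(s,t)\in E} n(s,t)$, where $n(s,t)$ is taken with respect to the whole point set, and the Orchard crossing number is ${\rm OCN}(G)=\min_{R(G)} n(R(G))$. **Proposition.** Let $n\ge 1$, and let $K_{n,1}$ be the star graph, with $n$ black vertices, each joined to one white vertex. Then $${\rm OCN}(K_{n,1})=\begin{cases}\dfrac{n(n-1)(n-3)}{8} & n \text{ odd},\\[2mm] \dfrac{n(n-2)^2}{8} & n\text{ even}.\end{cases}$$ Moreover, let $X$ be the vertex set of any regular $n$-gon, with center $c$ (for $n=1$: one point different from $c$; for $n=2$: two distinct points with midpoint $c$). If $n$ is odd, then placing the black points at $X$ and the white point at $c$ gives a rectilinear drawing of $K_{n,1}$, and it attains the minimum. If $n$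 is even, then there is a rectilinear drawing of $K_{n,1}$ with the black points at $X$ and the white point not separated from $c$ by any line through two points of $X$, and every such drawing attains the minimum. -/

import Mathlib

/-- The Euclidean plane `ℝ²`. -/
abbrev Plane : Type := EuclideanSpace ℝ (Fin 2)

/-- No three (distinct) points of `S` are collinear. -/
def IsGenericConfiguration (S : Set Plane) : Prop :=
  ∀ A ∈ S, ∀ B ∈ S, ∀ C ∈ S, A ≠ B → A ≠ C → B ≠ C → ¬ Collinear ℝ {A, B, C}

/-- `L` separates `P` and `Q`: neither lies on `L`, and they lie in different connected components
of the complement of `L`. -/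
def Separates (L : AffineSubspace ℝ Plane) (P Q : Plane) : Prop :=
  P ∉ L ∧ Q ∉ L ∧
    connectedComponentIn ((L : Set Plane)ᶜ) P ≠ connectedComponentIn ((L : Set Plane)ᶜ) Q

/-- `L` is the line through two distinct points of `S`. -/
def IsLineDefinedBy (S : Set Plane) (L : AffineSubspace ℝ Plane) : Prop :=
  ∃ A ∈ S, ∃ B ∈ S, A ≠ B ∧ L = line[ℝ, A, B]

/-- `n(P, Q)`: the number of lines defined by pairs of points of `S \ {P, Q}` which separate
`P` and `Q`. -/
noncomputable def numSeparatingLines (S : Set Plane) (P Q : Plane) : ℕ :=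
  {L : AffineSubspace ℝ Plane | IsLineDefinedBy (S \ {P, Q}) L ∧ Separates L P Q}.ncard

theorem Separates.symm {L : AffineSubspace ℝ Plane} {P Q : Plane} (h : Separates L P Q) :
    Separates L Q P :=
  ⟨h.2.1, h.1, h.2.2.symm⟩

theorem numSeparatingLines_comm (S : Set Plane) (P Q : Plane) :
    numSeparatingLines S P Q = numSeparatingLines S Q P := by
  have h : ∀ L, Separates L P Q ↔ Separates L Q P := fun L => ⟨Separates.symm, Separates.symm⟩
  simp only [numSeparatingLines, Set.pair_comm P Q, h]

/-- A rectilinear drawing of `G`: a generic set of points of the plane in bijection with the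
vertices of `G` (an edge `s(u, v)` is drawn as the segment from `pos u` to `pos v`). -/
structure RectilinearDrawing {V : Type*} (G : SimpleGraph V) where
  pos : V → Plane
  injective_pos : Function.Injective pos
  generic : IsGenericConfiguration (Set.range pos)

open Classical in
/-- `n(R(G))`: the sum of `n(s, t)` over all edges `(s, t)` of the graph. -/
noncomputable def RectilinearDrawing.crossingNumber {V : Type*} [Fintype V] {G : SimpleGraph V}
    (R : RectilinearDrawing G) : ℕ :=
  ∑ e ∈ G.edgeFinset,
    Sym2.lift ⟨fun s t => numSeparatingLines (Set.range R.pos) (R.pos s) (R.pos t),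
      fun _ _ => numSeparatingLines_comm _ _ _⟩ e

/-- The Orchard crossing number: the minimum of `n(R(G))` over all rectilinear drawings of `G`. -/
noncomputable def orchardCrossingNumber {V : Type*} [Fintype V] (G : SimpleGraph V) : ℕ :=
  sInf (Set.range fun R : RectilinearDrawing G => R.crossingNumber)

/-- The star graph `K_{n,1}`: black vertices `Sum.inl i`, one white vertex `Sum.inr 0`. -/
abbrev starGraph (n : ℕ) : SimpleGraph (Fin n ⊕ Fin 1) :=
  completeBipartiteGraph (Fin n) (Fin 1)

/-- The set of vertices of the regular `n`-gon with center `c`, circumradius `r` and a vertex in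
direction `θ`. -/
noncomputable def regularPolygon (n : ℕ) (c : Plane) (r θ : ℝ) : Set Plane :=
  Set.range fun k : Fin n =>
    c + !₂[r * Real.cos (θ + 2 * Real.pi * (k : ℝ) / n),
           r * Real.sin (θ + 2 * Real.pi * (k : ℝ) / n)]

/-- The black points of the drawing of `K_{n,1}`. -/
def RectilinearDrawing.blackPoints {n : ℕ} (R : RectilinearDrawing (starGraph n)) : Set Plane :=
  Set.range fun i : Fin n => R.pos (Sum.inl i)

/-- The white point of the drawing of `K_{n,1}`. -/
def RectilinearDrawing.whitePoint {n : ℕ} (R : RectilinearDrawing (starGraph n)) : Plane :=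
  R.pos (Sum.inr 0)

/-- The point `w` is close to the point `c` relative to `S`: no line through two points of `S`
separates them. -/
def NotSeparatedFrom (S : Set Plane) (w c : Plane) : Prop :=
  ∀ L : AffineSubspace ℝ Plane, IsLineDefinedBy S L → ¬ Separates L w c

/-! Let `w` be the white point, `b i` the black ones, and `t i j` twice the signed area of the
triangle `w, b i, b j`. The signs of `t` form a tournament on the black vertices. By additivity of
signed area, `b i, b j, b k` has signed area `t j k + t k i + t i j` (up to the same factor), and
the line through `b j`, `b k` separates `w` from `b i` exactly when `t j k` is opposite in sign to
this sum. So twice the crossing number is `oppositeTriples t`.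

A cyclic triple (`w` inside the triangle) contributes no separation. A transitive one contributes
one or two, and two only when `w` lies in the cone vertically opposite to the triangle at a vertex.
Hence the crossing number is at least the number of transitive triples, which is the sum of `d * (d
- 1) / 2` over the out-degrees `d`. Their mean is `(n - 1) / 2`, so by convexity the sum is least
for balanced degrees; for even `n` each degree misses the mean by at least `1 / 2`. This is
`four_mul_oppositeTriples_ge`.

For a regular polygon with `w` not separated from the center, the degrees are balanced, and the
center, being the circumcenter of every triangle of vertices, lies in no opposite cone
(`not_center_opposite`). Both inequalities are then equalities (`eight_mul_crossingNumber_eq`). -/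

/-- The sum over ordered triples of the separation indicators of a triangle dominates the number of
transitive triples. -/
theorem sum_sign_indicators_ge {p q r : ℝ} (hp : p ≠ 0) (hq : q ≠ 0) (hr : r ≠ 0)
    (hs : p + q + r ≠ 0) :
    ((if 0 < r ∧ q < 0 then 1 else 0) + (if 0 < p ∧ r < 0 then 1 else 0) +
      (if 0 < q ∧ p < 0 then 1 else 0) : ℤ) ≤
    (if p * (p + q + r) < 0 then 1 else 0) + (if q * (p + q + r) < 0 then 1 else 0) +
      (if r * (p + q + r) < 0 then 1 else 0) := by
  rcases hp.lt_or_gt with hp | hp <;> rcases hq.lt_or_gt with hq | hq <;>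
    rcases hr.lt_or_gt with hr | hr <;> rcases hs.lt_or_gt with hs | hs <;>
    simp [mul_neg_iff, hp, hq, hr, hs, hp.not_gt, hq.not_gt, hr.not_gt, hs.not_gt]

/-- If the signs are mixed, one or two of `p`, `q`, `r` oppose the sum; excluding two leaves exactly
one, matching the unique source of a transitive triple. Equal signs give zero on both sides. -/
theorem sum_sign_indicators_eq {p q r : ℝ} (hp : p ≠ 0) (hq : q ≠ 0) (hr : r ≠ 0)
    (hs : p + q + r ≠ 0)
    (hpq : ¬ (p * (p + q + r) < 0 ∧ q * (p + q + r) < 0))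
    (hqr : ¬ (q * (p + q + r) < 0 ∧ r * (p + q + r) < 0))
    (hrp : ¬ (r * (p + q + r) < 0 ∧ p * (p + q + r) < 0)) :
    ((if p * (p + q + r) < 0 then 1 else 0) + (if q * (p + q + r) < 0 then 1 else 0) +
      (if r * (p + q + r) < 0 then 1 else 0) : ℤ) =
    (if 0 < r ∧ q < 0 then 1 else 0) + (if 0 < p ∧ r < 0 then 1 else 0) +
      (if 0 < q ∧ p < 0 then 1 else 0) := by
  rcases hp.lt_or_gt with hp | hp <;> rcases hq.lt_or_gt with hq | hq <;>
    rcases hr.lt_or_gt with hr | hr <;> rcases hs.lt_or_gt with hs | hs <;>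
    simp [mul_neg_iff, hp, hq, hr, hs, hp.not_gt, hq.not_gt, hr.not_gt, hs.not_gt]
      at hpq hqr hrp ⊢

/-! ### Transitive triples and out-degrees in a tournament -/

section Tournament

variable {ι : Type*}

open Classical in
/-- The number of out-neighbours of `i` in the tournament of positive entries of `t`. -/
noncomputable def outDegree [Fintype ι] (t : ι → ι → ℝ) (i : ι) : ℕ :=
  (Finset.univ.filter fun j => 0 < t i j).card

open Classical in
/-- The number of ordered triples `(i, j, k)` for which `t j k` is opposite in sign to
`t j k + t k i + t i j`. -/
noncomputable def oppositeTriples [Fintype ι] (t : ι → ι → ℝ) : ℕ :=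
  (Finset.univ.filter fun x : ι × ι × ι =>
    t x.2.1 x.2.2 * (t x.2.1 x.2.2 + t x.2.2 x.1 + t x.1 x.2.1) < 0).card

/-- The indicators are comparable only after adding the three rotations of a triple, because the
source need not be the separated vertex. -/
theorem sum_rotate [Fintype ι] (F : ι → ι → ι → ℤ) :
    ∑ i, ∑ j, ∑ k, (F i j k + F j k i + F k i j) = 3 * ∑ i, ∑ j, ∑ k, F i j k := by
  have h1 : ∑ i, ∑ j, ∑ k, F j k i = ∑ i, ∑ j, ∑ k, F i j k := by
    rw [Finset.sum_comm]
    refine Finset.sum_congr rfl fun j _ => ?_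
    rw [Finset.sum_comm]
  have h2 : ∑ i, ∑ j, ∑ k, F k i j = ∑ i, ∑ j, ∑ k, F i j k := by
    conv_rhs => rw [Finset.sum_comm]
    exact Finset.sum_congr rfl fun i _ => Finset.sum_comm
  simp only [Finset.sum_add_distrib, h1, h2]
  ring

open Classical in
/-- The indicator of the triples `(i, j, k)` with `j ≠ k` in which `i` beats both `j` and `k`. -/
noncomputable def sourceIndicator (t : ι → ι → ℝ) (i j k : ι) : ℤ :=
  (if 0 < t i j then 1 else 0) * (if 0 < t i k then 1 else 0) -
    (if j = k then (if 0 < t i j then 1 else 0) else 0)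

open Classical in
/-- The indicator of the triples counted by `oppositeTriples`. -/
noncomputable def oppositeIndicator (t : ι → ι → ℝ) (i j k : ι) : ℤ :=
  if t j k * (t j k + t k i + t i j) < 0 then 1 else 0

theorem sourceIndicator_of_ne {t : ι → ι → ℝ} (hanti : ∀ i j, t i j = - t j i) {i j k : ι}
    (h : j ≠ k) : sourceIndicator t i j k = if 0 < t i j ∧ t k i < 0 then 1 else 0 := by
  have : t k i < 0 ↔ 0 < t i k := by rw [hanti k i]; simp
  by_cases h1 : 0 < t i j <;> by_cases h2 : 0 < t i k <;> simp [sourceIndicator, h, this, h1, h2]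

theorem sum_outDegree_eq [Fintype ι] (t : ι → ι → ℝ) (i : ι) :
    ∑ j, ∑ k, sourceIndicator t i j k = (outDegree t i : ℤ) * ((outDegree t i : ℤ) - 1) := by
  classical
  have h : (outDegree t i : ℤ) = ∑ j, if 0 < t i j then 1 else 0 := by
    simp [outDegree]
  simp only [sourceIndicator, Finset.sum_sub_distrib, Finset.sum_ite_eq, Finset.mem_univ, if_true]
  rw [← Finset.sum_mul_sum, ← h]
  ring

theorem oppositeTriples_eq_sum [Fintype ι] (t : ι → ι → ℝ) :
    (oppositeTriples t : ℤ) = ∑ i, ∑ j, ∑ k, oppositeIndicator t i j k := by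
  classical
  simp only [oppositeTriples, oppositeIndicator]
  rw [← Fintype.sum_prod_type', Finset.card_filter]
  push_cast
  rw [Fintype.sum_prod_type]
  simp_rw [Fintype.sum_prod_type]

theorem indicators_of_degenerate {t : ι → ι → ℝ} (hanti : ∀ i j, t i j = - t j i) {i j k : ι}
    (h : i = j ∨ j = k ∨ k = i) :
    sourceIndicator t i j k = 0 ∧ oppositeIndicator t i j k = 0 := by
  have h0 : ∀ i, t i i = 0 := fun i => by linarith [hanti i i]
  rcases h with rfl | rfl | rfl
  · refine ⟨by simp [sourceIndicator, h0], ?_⟩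
    simp [oppositeIndicator, h0, hanti k i]
  · refine ⟨?_, by simp [oppositeIndicator, h0]⟩
    by_cases h : 0 < t i j <;> simp [sourceIndicator, h]
  · refine ⟨?_, by simp [oppositeIndicator, h0, hanti k j]⟩
    by_cases h : j = k <;> simp [sourceIndicator, h0, h]

theorem sum_outDegree_le_oppositeTriples [Fintype ι] {t : ι → ι → ℝ} (hanti : ∀ i j, t i j = - t j i)
    (hne : ∀ i j, i ≠ j → t i j ≠ 0)
    (hsum : ∀ i j k, i ≠ j → j ≠ k → k ≠ i → t j k + t k i + t i j ≠ 0) :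
    ∑ i, (outDegree t i : ℤ) * ((outDegree t i : ℤ) - 1) ≤ oppositeTriples t := by
  simp_rw [← sum_outDegree_eq, oppositeTriples_eq_sum]
  refine le_of_mul_le_mul_left (a := (3 : ℤ)) ?_ (by norm_num)
  rw [← sum_rotate, ← sum_rotate]
  refine Finset.sum_le_sum fun i _ => Finset.sum_le_sum fun j _ => Finset.sum_le_sum fun k _ => ?_
  by_cases h : i = j ∨ j = k ∨ k = i
  · rw [(indicators_of_degenerate hanti h).1, (indicators_of_degenerate hanti h).2,
      (indicators_of_degenerate hanti (by tauto : j = k ∨ k = i ∨ i = j)).1,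
      (indicators_of_degenerate hanti (by tauto : j = k ∨ k = i ∨ i = j)).2,
      (indicators_of_degenerate hanti (by tauto : k = i ∨ i = j ∨ j = k)).1,
      (indicators_of_degenerate hanti (by tauto : k = i ∨ i = j ∨ j = k)).2]
  · push Not at h
    obtain ⟨h1, h2, h3⟩ := h
    have := sum_sign_indicators_ge (hne j k h2) (hne k i h3) (hne i j h1) (hsum i j k h1 h2 h3)
    rw [sourceIndicator_of_ne hanti h2, sourceIndicator_of_ne hanti h3,
      sourceIndicator_of_ne hanti h1]
    simp only [oppositeIndicator]
    rw [show t k i + t i j + t j k = t j k + t k i + t i j by ring,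
      show t i j + t j k + t k i = t j k + t k i + t i j by ring]
    exact this

theorem oppositeTriples_eq_sum_outDegree [Fintype ι] {t : ι → ι → ℝ} (hanti : ∀ i j, t i j = - t j i)
    (hne : ∀ i j, i ≠ j → t i j ≠ 0)
    (hsum : ∀ i j k, i ≠ j → j ≠ k → k ≠ i → t j k + t k i + t i j ≠ 0)
    (htwo : ∀ i j k, i ≠ j → j ≠ k → k ≠ i → ¬ (t j k * (t j k + t k i + t i j) < 0 ∧
      t k i * (t j k + t k i + t i j) < 0)) :
    (oppositeTriples t : ℤ) = ∑ i, (outDegree t i : ℤ) * ((outDegree t i : ℤ) - 1) := by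
  simp_rw [← sum_outDegree_eq, oppositeTriples_eq_sum]
  refine mul_left_cancel₀ (a := (3 : ℤ)) (by norm_num) ?_
  rw [← sum_rotate, ← sum_rotate]
  refine Finset.sum_congr rfl fun i _ => Finset.sum_congr rfl fun j _ =>
    Finset.sum_congr rfl fun k _ => ?_
  by_cases h : i = j ∨ j = k ∨ k = i
  · rw [(indicators_of_degenerate hanti h).1, (indicators_of_degenerate hanti h).2,
      (indicators_of_degenerate hanti (by tauto : j = k ∨ k = i ∨ i = j)).1,
      (indicators_of_degenerate hanti (by tauto : j = k ∨ k = i ∨ i = j)).2,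
      (indicators_of_degenerate hanti (by tauto : k = i ∨ i = j ∨ j = k)).1,
      (indicators_of_degenerate hanti (by tauto : k = i ∨ i = j ∨ j = k)).2]
  · push Not at h
    obtain ⟨h1, h2, h3⟩ := h
    have e1 : t k i + t i j + t j k = t j k + t k i + t i j := by ring
    have e2 : t i j + t j k + t k i = t j k + t k i + t i j := by ring
    have := sum_sign_indicators_eq (hne j k h2) (hne k i h3) (hne i j h1) (hsum i j k h1 h2 h3)
      (htwo i j k h1 h2 h3) (by simpa only [e1] using htwo j k i h2 h3 h1)
      (by simpa only [e2] using htwo k i j h3 h1 h2)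
    rw [sourceIndicator_of_ne hanti h2, sourceIndicator_of_ne hanti h3,
      sourceIndicator_of_ne hanti h1]
    simp only [oppositeIndicator]
    rw [e1, e2]
    exact this

theorem two_mul_sum_outDegree [Fintype ι] {t : ι → ι → ℝ} (hanti : ∀ i j, t i j = - t j i)
    (hne : ∀ i j, i ≠ j → t i j ≠ 0) :
    2 * ∑ i, (outDegree t i : ℤ) = (Fintype.card ι : ℤ) * ((Fintype.card ι : ℤ) - 1) := by
  classical
  have h0 : ∀ i, t i i = 0 := fun i => by linarith [hanti i i]
  have h : ∀ i, (outDegree t i : ℤ) = ∑ j, if 0 < t i j then 1 else 0 := fun i => by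
    simp [outDegree]
  have h2 : ∑ i, (outDegree t i : ℤ) = ∑ i, ∑ j, if 0 < t j i then (1 : ℤ) else 0 := by
    simp_rw [h]
    exact Finset.sum_comm
  have h3 : ∀ i j, ((if 0 < t i j then 1 else 0) + (if 0 < t j i then 1 else 0) : ℤ) =
      1 - if i = j then 1 else 0 := by
    intro i j
    by_cases hij : i = j
    · simp [hij, h0]
    · have h4 := hanti i j
      rcases (hne i j hij).lt_or_gt with h5 | h5
      · have : 0 < t j i := by linarith
        simp [hij, this, h5.not_gt]
      · have : ¬ 0 < t j i := by linarith
        simp [hij, this, h5]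
  calc 2 * ∑ i, (outDegree t i : ℤ)
      = ∑ i, (outDegree t i : ℤ) + ∑ i, (outDegree t i : ℤ) := by ring
    _ = ∑ i : ι, ∑ j : ι, (1 - if i = j then 1 else 0 : ℤ) := by
        nth_rewrite 2 [h2]
        simp only [h, ← Finset.sum_add_distrib, h3]
    _ = _ := by
        simp only [Finset.sum_sub_distrib, Finset.sum_ite_eq, Finset.mem_univ, if_true,
          Finset.sum_const, Finset.card_univ, nsmul_eq_mul]
        ring

/-- Completing the square about the mean out-degree: the total degree is fixed, so only the variance
term depends on the tournament. -/
theorem four_mul_sum_outDegree [Fintype ι] {t : ι → ι → ℝ} (hanti : ∀ i j, t i j = - t j i)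
    (hne : ∀ i j, i ≠ j → t i j ≠ 0) :
    4 * ∑ i, (outDegree t i : ℤ) * ((outDegree t i : ℤ) - 1) =
      ∑ i, (2 * (outDegree t i : ℤ) - ((Fintype.card ι : ℤ) - 1)) ^ 2 +
        (Fintype.card ι : ℤ) * ((Fintype.card ι : ℤ) - 1) * ((Fintype.card ι : ℤ) - 3) := by
  have h := two_mul_sum_outDegree hanti hne
  set N : ℤ := (Fintype.card ι : ℤ) with hN
  have h1 : ∑ i, (2 * (outDegree t i : ℤ) - (N - 1)) ^ 2 =
      4 * ∑ i, (outDegree t i : ℤ) * ((outDegree t i : ℤ) - 1) -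
        (4 * N - 8) * ∑ i, (outDegree t i : ℤ) + N * (N - 1) ^ 2 := by
    have h2 : N * (N - 1) ^ 2 = ∑ i : ι, (N - 1) ^ 2 := by simp [hN]
    rw [h2, Finset.mul_sum, Finset.mul_sum, ← Finset.sum_sub_distrib, ← Finset.sum_add_distrib]
    exact Finset.sum_congr rfl fun i _ => by ring
  rw [h1]
  linear_combination (2 * N - 4) * h

theorem four_mul_oppositeTriples_ge [Fintype ι] {t : ι → ι → ℝ} (hanti : ∀ i j, t i j = - t j i)
    (hne : ∀ i j, i ≠ j → t i j ≠ 0)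
    (hsum : ∀ i j k, i ≠ j → j ≠ k → k ≠ i → t j k + t k i + t i j ≠ 0) :
    (Fintype.card ι : ℤ) * ((Fintype.card ι : ℤ) - 1) * ((Fintype.card ι : ℤ) - 3) +
      (if Even (Fintype.card ι) then (Fintype.card ι : ℤ) else 0) ≤ 4 * oppositeTriples t := by
  have h1 := sum_outDegree_le_oppositeTriples hanti hne hsum
  have h2 := four_mul_sum_outDegree hanti hne
  have h3 : (if Even (Fintype.card ι) then (Fintype.card ι : ℤ) else 0) ≤
      ∑ i, (2 * (outDegree t i : ℤ) - ((Fintype.card ι : ℤ) - 1)) ^ 2 := by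
    split_ifs with he
    · calc (Fintype.card ι : ℤ) = ∑ i : ι, 1 := by simp
        _ ≤ _ := Finset.sum_le_sum fun i _ => by
          -- For an even number of vertices this integer is odd, so its square is at least 1.
          have : 2 * (outDegree t i : ℤ) - ((Fintype.card ι : ℤ) - 1) ≠ 0 := by
            obtain ⟨m, hm⟩ := he
            omega
          have := sq_pos_of_ne_zero this
          omega
    · positivity
  linarith

/-- `htwo` makes the triangle bound sharp; `hdeg` puts each out-degree at an integer nearest to the
mean, so that each square is 0 or 1 according to parity. -/
theorem four_mul_oppositeTriples_eq [Fintype ι] {t : ι → ι → ℝ} (hanti : ∀ i j, t i j = - t j i)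
    (hne : ∀ i j, i ≠ j → t i j ≠ 0)
    (hsum : ∀ i j k, i ≠ j → j ≠ k → k ≠ i → t j k + t k i + t i j ≠ 0)
    (htwo : ∀ i j k, i ≠ j → j ≠ k → k ≠ i → ¬ (t j k * (t j k + t k i + t i j) < 0 ∧
      t k i * (t j k + t k i + t i j) < 0))
    (hdeg : ∀ i, 2 * outDegree t i ≤ Fintype.card ι ∧ Fintype.card ι ≤ 2 * outDegree t i + 2) :
    4 * (oppositeTriples t : ℤ) =
      (Fintype.card ι : ℤ) * ((Fintype.card ι : ℤ) - 1) * ((Fintype.card ι : ℤ) - 3) +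
      (if Even (Fintype.card ι) then (Fintype.card ι : ℤ) else 0) := by
  rw [oppositeTriples_eq_sum_outDegree hanti hne hsum htwo, four_mul_sum_outDegree hanti hne,
    add_comm]
  congr 1
  have h : ∀ i, (2 * (outDegree t i : ℤ) - ((Fintype.card ι : ℤ) - 1)) ^ 2 =
      if Even (Fintype.card ι) then 1 else 0 := fun i => by
    obtain ⟨h1, h2⟩ := hdeg i
    split_ifs with he
    · obtain ⟨m, hm⟩ := he
      rcases (by omega : 2 * (outDegree t i : ℤ) - ((Fintype.card ι : ℤ) - 1) = 1 ∨
        2 * (outDegree t i : ℤ) - ((Fintype.card ι : ℤ) - 1) = -1) with h | h <;> rw [h] <;> rfl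
    · obtain ⟨m, hm⟩ := Nat.not_even_iff_odd.1 he
      rw [sq_eq_zero_iff]
      omega
  simp only [h]
  split_ifs <;> simp

end Tournament

/-! ### Signed area and separation by a line -/

/-- Twice the signed area of the triangle `ABC`. -/
def orient (A B C : Plane) : ℝ :=
  (B 0 - A 0) * (C 1 - A 1) - (B 1 - A 1) * (C 0 - A 0)

theorem orient_swap (A B C : Plane) : orient A B C = -orient A C B := by
  unfold orient; ring

theorem orient_rotate (A B C : Plane) : orient A B C = orient B C A := by
  unfold orient; ring

theorem orient_eq_add (W A B C : Plane) :
    orient A B C = orient W B C + orient W C A + orient W A B := by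
  unfold orient; ring

theorem continuous_orient (A B : Plane) : Continuous fun P => orient P A B := by
  unfold orient; fun_prop

theorem orient_lineMap (A B P Q : Plane) (s : ℝ) :
    orient (AffineMap.lineMap P Q s) A B = (1 - s) * orient P A B + s * orient Q A B := by
  simp only [orient, AffineMap.lineMap_apply, vsub_eq_sub, vadd_eq_add, PiLp.add_apply,
    PiLp.smul_apply, PiLp.sub_apply, smul_eq_mul]
  ring

theorem mem_line_iff_orient {A B : Plane} (h : A ≠ B) (P : Plane) :
    P ∈ line[ℝ, A, B] ↔ orient P A B = 0 := by
  rw [mem_affineSpan_pair_iff_exists_lineMap_eq]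
  constructor
  · rintro ⟨s, rfl⟩
    rw [orient_lineMap]
    simp only [orient]
    ring
  · intro hP
    have hne : (B 0 - A 0) ≠ 0 ∨ (B 1 - A 1) ≠ 0 := by
      by_contra! h0
      refine h (PiLp.ext fun i => ?_)
      fin_cases i
      · exact (sub_eq_zero.1 h0.1).symm
      · exact (sub_eq_zero.1 h0.2).symm
    unfold orient at hP
    rcases hne with h0 | h0
    · refine ⟨(P 0 - A 0) / (B 0 - A 0), PiLp.ext fun i => ?_⟩
      fin_cases i <;>
        simp only [AffineMap.lineMap_apply, vsub_eq_sub, vadd_eq_add, PiLp.add_apply,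
          PiLp.smul_apply, PiLp.sub_apply, smul_eq_mul, Fin.mk_one, Fin.zero_eta] <;>
        field_simp
      · ring
      · linear_combination -hP
    · refine ⟨(P 1 - A 1) / (B 1 - A 1), PiLp.ext fun i => ?_⟩
      fin_cases i <;>
        simp only [AffineMap.lineMap_apply, vsub_eq_sub, vadd_eq_add, PiLp.add_apply,
          PiLp.smul_apply, PiLp.sub_apply, smul_eq_mul, Fin.mk_one, Fin.zero_eta] <;>
        field_simp
      · linear_combination hP
      · ring

theorem collinear_iff_orient {A B : Plane} (h : A ≠ B) (P : Plane) :
    Collinear ℝ {P, A, B} ↔ orient P A B = 0 := by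
  rw [← mem_line_iff_orient h]
  constructor
  · intro hc
    exact hc.mem_affineSpan_of_mem_of_ne (by simp) (by simp) (by simp) h
  · exact collinear_insert_of_mem_affineSpan_pair

/-- On one side, the segment from `P` to `Q` avoids the line and stays in one component. For
opposite sides, the image of a common component under the continuous map `orient · A B` would be an
interval containing 0. -/
theorem separates_line_iff {A B : Plane} (h : A ≠ B) (P Q : Plane) :
    Separates line[ℝ, A, B] P Q ↔ orient P A B * orient Q A B < 0 := by
  have hmem : ∀ X : Plane, X ∈ ((line[ℝ, A, B] : AffineSubspace ℝ Plane) : Set Plane)ᶜ ↔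
      orient X A B ≠ 0 := fun X => by
    rw [Set.mem_compl_iff, SetLike.mem_coe, mem_line_iff_orient h]
  unfold Separates
  rw [mem_line_iff_orient h, mem_line_iff_orient h]
  constructor
  · rintro ⟨hP, hQ, hne⟩
    by_contra hpos
    refine hne (connectedComponentIn_eq ?_)
    have hseg : segment ℝ P Q ⊆ ((line[ℝ, A, B] : AffineSubspace ℝ Plane) : Set Plane)ᶜ := by
      intro X hX
      rw [segment_eq_image_lineMap] at hX
      obtain ⟨s, ⟨hs0, hs1⟩, rfl⟩ := hX
      rw [hmem, orient_lineMap]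
      have hs : 0 ≤ 1 - s := by linarith
      rcases lt_or_gt_of_ne hP with hP' | hP' <;> rcases lt_or_gt_of_ne hQ with hQ' | hQ'
      · rcases hs0.eq_or_lt with rfl | hs0
        · simpa using hP
        · nlinarith [mul_nonneg hs (neg_nonneg.2 hP'.le), mul_pos hs0 (neg_pos.2 hQ')]
      · exact absurd (mul_neg_of_neg_of_pos hP' hQ') hpos
      · exact absurd (mul_neg_of_pos_of_neg hP' hQ') hpos
      · rcases hs0.eq_or_lt with rfl | hs0
        · simpa using hP
        · nlinarith [mul_nonneg hs hP'.le, mul_pos hs0 hQ']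
    exact (convex_segment P Q).isPreconnected.subset_connectedComponentIn
      (left_mem_segment ℝ P Q) hseg (right_mem_segment ℝ P Q)
  · intro hlt
    have hP : orient P A B ≠ 0 := left_ne_zero_of_mul hlt.ne
    have hQ : orient Q A B ≠ 0 := right_ne_zero_of_mul hlt.ne
    refine ⟨hP, hQ, fun heq => ?_⟩
    have h1 := mem_connectedComponentIn ((hmem P).2 hP)
    have h2 := mem_connectedComponentIn ((hmem Q).2 hQ)
    rw [← heq] at h2
    have hpre := (isPreconnected_connectedComponentIn
      (x := P) (F := ((line[ℝ, A, B] : AffineSubspace ℝ Plane) : Set Plane)ᶜ)).image _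
      (continuous_orient A B).continuousOn
    have hzero : (0 : ℝ) ∈ (fun X => orient X A B) '' connectedComponentIn
        ((line[ℝ, A, B] : AffineSubspace ℝ Plane) : Set Plane)ᶜ P := by
      rcases mul_neg_iff.1 hlt with ⟨ha, hb⟩ | ⟨ha, hb⟩
      · exact hpre.ordConnected.out ⟨Q, h2, rfl⟩ ⟨P, h1, rfl⟩ ⟨hb.le, ha.le⟩
      · exact hpre.ordConnected.out ⟨P, h1, rfl⟩ ⟨Q, h2, rfl⟩ ⟨ha.le, hb.le⟩
    obtain ⟨X, hX, hX0⟩ := hzero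
    exact (hmem X).1 (connectedComponentIn_subset _ _ hX) hX0

/-! ### Crossing number as a count of triples -/

namespace RectilinearDrawing

variable {n : ℕ} (R : RectilinearDrawing (starGraph n))

/-- The position of the `i`-th black vertex. -/
def black (i : Fin n) : Plane := R.pos (Sum.inl i)

theorem black_injective : Function.Injective R.black :=
  R.injective_pos.comp Sum.inl_injective

theorem orient_pos_ne_zero {u v x : Fin n ⊕ Fin 1} (h1 : u ≠ v) (h2 : v ≠ x) (h3 : u ≠ x) :
    orient (R.pos u) (R.pos v) (R.pos x) ≠ 0 := by
  rw [Ne, ← collinear_iff_orient (R.injective_pos.ne h2)]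
  exact R.generic _ ⟨u, rfl⟩ _ ⟨v, rfl⟩ _ ⟨x, rfl⟩ (R.injective_pos.ne h1) (R.injective_pos.ne h3)
    (R.injective_pos.ne h2)

theorem orient_black_ne_zero {i j k : Fin n} (h1 : i ≠ j) (h2 : j ≠ k) (h3 : i ≠ k) :
    orient (R.black i) (R.black j) (R.black k) ≠ 0 :=
  R.orient_pos_ne_zero (Sum.inl_injective.ne h1) (Sum.inl_injective.ne h2)
    (Sum.inl_injective.ne h3)

theorem orient_whitePoint_ne_zero {i j : Fin n} (h : i ≠ j) :
    orient R.whitePoint (R.black i) (R.black j) ≠ 0 :=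
  R.orient_pos_ne_zero (by simp) (Sum.inl_injective.ne h) (by simp)

theorem crossingNumber_eq_sum :
    R.crossingNumber = ∑ i, numSeparatingLines (Set.range R.pos) (R.black i) R.whitePoint := by
  classical
  unfold crossingNumber
  have h : (starGraph n).edgeFinset =
      Finset.univ.image fun i : Fin n => s(Sum.inl i, (Sum.inr 0 : Fin n ⊕ Fin 1)) := by
    ext e
    induction e with | _ u v
    rcases u with u | u <;> rcases v with v | v <;>
      simp [SimpleGraph.mem_edgeFinset, completeBipartiteGraph, Subsingleton.elim _ (0 : Fin 1)]
  rw [h, Finset.sum_image]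
  · rfl
  · intro i _ j _ hij
    simpa using hij

theorem line_black_eq_iff {i j k l : Fin n} (h1 : i ≠ j) (h2 : k ≠ l) :
    line[ℝ, R.black i, R.black j] = line[ℝ, R.black k, R.black l] ↔
      (i, j) = (k, l) ∨ (i, j) = (l, k) := by
  constructor
  · intro h
    have hmem : ∀ x, R.black x ∈ line[ℝ, R.black k, R.black l] → x = k ∨ x = l := by
      intro x hx
      by_contra! hne
      rw [mem_line_iff_orient (R.black_injective.ne h2)] at hx
      exact R.orient_black_ne_zero hne.1 h2 hne.2 hx
    have hi := hmem i (h ▸ left_mem_affineSpan_pair ℝ _ _)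
    have hj := hmem j (h ▸ right_mem_affineSpan_pair ℝ _ _)
    rcases hi with rfl | rfl <;> rcases hj with rfl | rfl <;> simp_all
  · rintro (h | h)
    · simp_all
    · simp only [Prod.mk.injEq] at h
      rw [h.1, h.2, Set.pair_comm]

open Classical in
/-- The ordered pairs of black vertices whose line separates the `i`-th black vertex from the white
vertex. -/
noncomputable def separatingPairs (i : Fin n) : Finset (Fin n × Fin n) :=
  Finset.univ.filter fun x => orient R.whitePoint (R.black x.1) (R.black x.2) *
    orient (R.black i) (R.black x.1) (R.black x.2) < 0

/-- Degenerate pairs and lines through `b i` make the product vanish, so the deletion of the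
endpoints in the definition of `n(P, Q)` is automatic here. -/
theorem ne_of_mem_separatingPairs {i : Fin n} {x : Fin n × Fin n}
    (hx : x ∈ R.separatingPairs i) : i ≠ x.1 ∧ i ≠ x.2 ∧ x.1 ≠ x.2 := by
  simp only [separatingPairs, Finset.mem_filter, Finset.mem_univ, true_and] at hx
  refine ⟨?_, ?_, ?_⟩ <;> intro h <;> rw [h] at hx <;> revert hx <;> simp only [orient] <;>
    ring_nf <;> simp

/-- By genericity a line carries only two black points, so it arises from exactly two ordered pairs.
-/
theorem two_mul_numSeparatingLines (i : Fin n) :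
    2 * numSeparatingLines (Set.range R.pos) (R.black i) R.whitePoint =
      (R.separatingPairs i).card := by
  classical
  set line : Fin n × Fin n → AffineSubspace ℝ Plane :=
    fun x => line[ℝ, R.black x.1, R.black x.2] with hline
  have hsep : ∀ x : Fin n × Fin n, x.1 ≠ x.2 →
      (Separates (line x) (R.black i) R.whitePoint ↔ x ∈ R.separatingPairs i) := by
    intro x hx
    rw [hline, separates_line_iff (R.black_injective.ne hx), mul_comm]
    simp [separatingPairs]
  have hset : {L | IsLineDefinedBy (Set.range R.pos \ {R.black i, R.whitePoint}) L ∧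
      Separates L (R.black i) R.whitePoint} = ((R.separatingPairs i).image line : Set _) := by
    ext L
    simp only [Set.mem_ofPred_eq, Finset.coe_image, Set.mem_image, SetLike.mem_coe]
    constructor
    · rintro ⟨⟨A, ⟨⟨a, rfl⟩, ha⟩, B, ⟨⟨b, rfl⟩, hb⟩, hab, rfl⟩, hs⟩
      rcases a with a | a
      · rcases b with b | b
        · have hne : a ≠ b := fun h => hab (by rw [h])
          exact ⟨(a, b), (hsep (a, b) hne).1 hs, rfl⟩
        · exact absurd (Or.inr (by rw [Subsingleton.elim b 0]; rfl)) hb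
      · exact absurd (Or.inr (by rw [Subsingleton.elim a 0]; rfl)) ha
    · rintro ⟨x, hx, rfl⟩
      obtain ⟨h1, h2, h3⟩ := R.ne_of_mem_separatingPairs hx
      have hmem : ∀ j, i ≠ j → R.black j ∈ Set.range R.pos \ {R.black i, R.whitePoint} := by
        intro j hj
        refine ⟨⟨_, rfl⟩, ?_⟩
        rintro (h | h)
        · exact hj (R.black_injective h).symm
        · have := R.injective_pos h
          simp at this
      exact ⟨⟨_, hmem _ h1, _, hmem _ h2, R.black_injective.ne h3, rfl⟩, (hsep x h3).2 hx⟩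
  rw [numSeparatingLines, hset, Set.ncard_coe_finset,
    Finset.card_eq_sum_card_image line (R.separatingPairs i), mul_comm, ← smul_eq_mul,
    ← Finset.sum_const]
  refine Finset.sum_congr rfl fun L hL => ?_
  obtain ⟨x, hx, rfl⟩ := Finset.mem_image.1 hL
  obtain ⟨-, -, h3⟩ := R.ne_of_mem_separatingPairs hx
  have : (R.separatingPairs i).filter (fun y => line y = line x) = {x, (x.2, x.1)} := by
    ext y
    simp only [Finset.mem_filter, Finset.mem_insert, Finset.mem_singleton]
    constructor
    · rintro ⟨hy, h⟩
      exact (R.line_black_eq_iff (R.ne_of_mem_separatingPairs hy).2.2 h3).1 h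
    · rintro (rfl | rfl)
      · exact ⟨hx, rfl⟩
      · have hl : line (x.2, x.1) = line x := by simp only [hline, Set.pair_comm]
        refine ⟨?_, hl⟩
        rw [← hsep _ h3.symm, hl, hsep _ h3]
        exact hx
  rw [this, Finset.card_pair]
  intro h
  exact h3 (congrArg Prod.fst h)

/-- The orientations of the triangles formed by the white vertex and two black vertices. -/
def tournament (i j : Fin n) : ℝ := orient R.whitePoint (R.black i) (R.black j)

theorem two_mul_crossingNumber : 2 * R.crossingNumber = oppositeTriples R.tournament := by
  classical
  rw [crossingNumber_eq_sum, Finset.mul_sum]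
  simp_rw [two_mul_numSeparatingLines, separatingPairs, oppositeTriples, Finset.card_filter]
  rw [Fintype.sum_prod_type (fun x : Fin n × Fin n × Fin n => _)]
  simp only [tournament, ← orient_eq_add]

theorem tournament_antisymm (i j : Fin n) : R.tournament i j = -R.tournament j i :=
  orient_swap _ _ _

theorem tournament_sum_ne_zero (i j k : Fin n) (h1 : i ≠ j) (h2 : j ≠ k) (h3 : k ≠ i) :
    R.tournament j k + R.tournament k i + R.tournament i j ≠ 0 := by
  rw [tournament, tournament, tournament, ← orient_eq_add]
  exact R.orient_black_ne_zero h1 h2 h3.symm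

theorem eight_mul_crossingNumber_ge :
    (n : ℤ) * ((n : ℤ) - 1) * ((n : ℤ) - 3) + (if Even n then (n : ℤ) else 0) ≤
      8 * R.crossingNumber := by
  have h := four_mul_oppositeTriples_ge R.tournament_antisymm
    (fun _ _ => R.orient_whitePoint_ne_zero) R.tournament_sum_ne_zero
  rw [← two_mul_crossingNumber, Fintype.card_fin] at h
  push_cast at h
  linarith

end RectilinearDrawing

/-! ### Geometry of the regular polygon -/

/-- The `k`-th vertex of the regular `n`-gon. -/
noncomputable def polygonVertex (n : ℕ) (c : Plane) (r θ : ℝ) (k : Fin n) : Plane :=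
  c + !₂[r * Real.cos (θ + 2 * Real.pi * (k : ℝ) / n),
         r * Real.sin (θ + 2 * Real.pi * (k : ℝ) / n)]

section Polygon

variable (n : ℕ) (c : Plane) (r θ : ℝ)

theorem polygonVertex_zero (k : Fin n) :
    polygonVertex n c r θ k 0 = c 0 + r * Real.cos (θ + 2 * Real.pi * (k : ℝ) / n) := by
  simp [polygonVertex]

theorem polygonVertex_one (k : Fin n) :
    polygonVertex n c r θ k 1 = c 1 + r * Real.sin (θ + 2 * Real.pi * (k : ℝ) / n) := by
  simp [polygonVertex]

theorem orient_center_polygonVertex (i j : Fin n) :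
    orient c (polygonVertex n c r θ i) (polygonVertex n c r θ j) =
      r ^ 2 * Real.sin (2 * Real.pi * ((j : ℝ) - i) / n) := by
  have h : 2 * Real.pi * ((j : ℝ) - i) / n =
    (θ + 2 * Real.pi * (j : ℝ) / n) - (θ + 2 * Real.pi * (i : ℝ) / n) := by ring
  rw [h, Real.sin_sub]
  simp only [orient, polygonVertex_zero, polygonVertex_one]
  ring

theorem sq_add_sq_polygonVertex (k : Fin n) :
    (polygonVertex n c r θ k 0 - c 0) ^ 2 + (polygonVertex n c r θ k 1 - c 1) ^ 2 = r ^ 2 := by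
  rw [polygonVertex_zero, polygonVertex_one]
  linear_combination r ^ 2 * Real.sin_sq_add_cos_sq (θ + 2 * Real.pi * (k : ℝ) / n)

theorem polygonVertex_ne_center {r : ℝ} (hr : 0 < r) (k : Fin n) :
    polygonVertex n c r θ k ≠ c := by
  intro h
  have := sq_add_sq_polygonVertex n c r θ k
  rw [h] at this
  nlinarith

variable {n}

theorem eq_of_mul_eq_sub {i j : Fin n} {m : ℤ} (h : m * (n : ℤ) = (i : ℤ) - j) : i = j := by
  have h1 : ((i : ℤ) - j).natAbs < ((n : ℤ)).natAbs := by omega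
  have h2 : (i : ℤ) - j = 0 := Int.eq_zero_of_dvd_of_natAbs_lt_natAbs ⟨m, by linarith⟩ h1
  exact Fin.ext (by omega)

theorem polygonVertex_injective {r : ℝ} (hr : 0 < r) :
    Function.Injective (polygonVertex n c r θ) := by
  intro i j h
  have hn : (n : ℝ) ≠ 0 := by
    have := i.pos
    positivity
  have h0 := congrArg (fun P : Plane => P 0) h
  have h1 := congrArg (fun P : Plane => P 1) h
  simp only [polygonVertex_zero, polygonVertex_one, add_right_inj, mul_right_inj' hr.ne'] at h0 h1
  have hcos : Real.cos (2 * Real.pi * ((i : ℝ) - j) / n) = 1 := by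
    have : 2 * Real.pi * ((i : ℝ) - j) / n =
      (θ + 2 * Real.pi * (i : ℝ) / n) - (θ + 2 * Real.pi * (j : ℝ) / n) := by ring
    rw [this, Real.cos_sub, h0, h1]
    linear_combination Real.sin_sq_add_cos_sq (θ + 2 * Real.pi * (j : ℝ) / n)
  obtain ⟨m, hm⟩ := (Real.cos_eq_one_iff _).1 hcos
  refine eq_of_mul_eq_sub (m := m) ?_
  have hpi := Real.pi_ne_zero
  field_simp at hm
  exact_mod_cast hm

/-- A zero would force `n ∣ 2 * (j - i)`: an odd polygon has no diametrically opposite vertices. -/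
theorem sin_ne_zero_of_odd (hodd : Odd n) {i j : Fin n} (hij : i ≠ j) :
    Real.sin (2 * Real.pi * ((j : ℝ) - i) / n) ≠ 0 := by
  intro h
  have hn : (n : ℝ) ≠ 0 := by
    have := i.pos
    positivity
  obtain ⟨m, hm⟩ := Real.sin_eq_zero_iff.1 h
  have hpi := Real.pi_ne_zero
  field_simp at hm
  have hm' : m * (n : ℤ) = 2 * ((j : ℤ) - i) := by exact_mod_cast hm
  have heven : Even (m * (n : ℤ)) := ⟨(j : ℤ) - i, by linarith⟩
  rcases Int.even_mul.1 heven with ⟨l, hl⟩ | hne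
  · exact hij (eq_of_mul_eq_sub (m := l) (by rw [hl] at hm'; linarith)).symm
  · exact absurd hodd (Nat.not_odd_iff_even.2 (by exact_mod_cast hne))

/-- The number of steps from vertex `a` to vertex `b` of the `n`-gon in the positive direction. -/
def cyclicGap (a b : Fin n) : ℕ := if a ≤ b then (b : ℕ) - a else n + b - a

theorem two_mul_cyclicGap_le {a b : Fin n}
    (h : 0 ≤ Real.sin (2 * Real.pi * ((b : ℝ) - a) / n)) : 2 * cyclicGap a b ≤ n := by
  have hnpos : (0 : ℝ) < n := by exact_mod_cast a.pos
  have hlt : cyclicGap a b < n := by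
    unfold cyclicGap
    split_ifs with hab
    · omega
    · rw [not_le, Fin.lt_def] at hab
      omega
  have hsin : Real.sin (2 * Real.pi * ((b : ℝ) - a) / n) =
      Real.sin (2 * Real.pi * (cyclicGap a b : ℝ) / n) := by
    unfold cyclicGap
    split_ifs with hab
    · rw [Fin.le_def] at hab
      rw [Nat.cast_sub hab]
    · rw [Nat.cast_sub (by omega), ← Real.sin_add_two_pi]
      congr 1
      push_cast
      field_simp
      ring
  by_contra! hgap
  -- A gap beyond half a turn becomes, after subtracting `2π`, an angle strictly between `-π` and 0,
  -- where the sine is negative.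
  rw [hsin, ← Real.sin_sub_two_pi] at h
  have h1 : (n : ℝ) < 2 * cyclicGap a b := by exact_mod_cast hgap
  have h2 : (cyclicGap a b : ℝ) < n := by exact_mod_cast hlt
  have hpi := Real.pi_pos
  refine h.not_gt (Real.sin_neg_of_neg_of_neg_pi_lt ?_ ?_)
  · rw [sub_neg, div_lt_iff₀ hnpos]
    nlinarith
  · rw [lt_sub_iff_add_lt, lt_div_iff₀ hnpos]
    nlinarith

theorem cyclicGap_pos {a b : Fin n} (h : a ≠ b) : 0 < cyclicGap a b := by
  have := Fin.val_ne_of_ne h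
  unfold cyclicGap
  split_ifs with hab
  · rw [Fin.le_def] at hab
    omega
  · omega

theorem cyclicGap_right_injective (a : Fin n) : Function.Injective (cyclicGap a) := by
  intro b d h
  unfold cyclicGap at h
  refine Fin.ext ?_
  split_ifs at h with h1 h2 h2 <;> simp only [Fin.le_def] at h1 h2 <;> omega

theorem cyclicGap_left_injective (a : Fin n) : Function.Injective fun b => cyclicGap b a := by
  intro b d h
  simp only [cyclicGap] at h
  refine Fin.ext ?_
  split_ifs at h with h1 h2 h2 <;> simp only [Fin.le_def] at h1 h2 <;> omega

theorem two_mul_card_le_of_gap {s : Finset (Fin n)} {f : Fin n → ℕ} (hf : Function.Injective f)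
    (h : ∀ j ∈ s, 0 < f j ∧ 2 * f j ≤ n) : 2 * s.card ≤ n := by
  have : s.card ≤ (Finset.Icc 1 (n / 2)).card :=
    Finset.card_le_card_of_injOn f (fun j hj => by
      have := h j hj
      simp only [Finset.coe_Icc, Set.mem_Icc]
      omega) hf.injOn
  rw [Nat.card_Icc] at this
  omega

/-- The center of a circle does not lie, even weakly, in the cone vertically opposite to an inscribed
triangle at one of its vertices. -/
theorem not_center_opposite {c x y z : Plane} {r : ℝ} (hr : 0 < r)
    (hx : (x 0 - c 0) ^ 2 + (x 1 - c 1) ^ 2 = r ^ 2)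
    (hy : (y 0 - c 0) ^ 2 + (y 1 - c 1) ^ 2 = r ^ 2)
    (hz : (z 0 - c 0) ^ 2 + (z 1 - c 1) ^ 2 = r ^ 2) (hne : orient x y z ≠ 0)
    (hp : orient c y z * orient x y z ≤ 0) (hq : orient c z x * orient x y z ≤ 0) : False := by
  have hsum := orient_eq_add c x y z
  -- The three areas are barycentric weights of `c`.
  have h0 : orient c y z * (x 0 - c 0) + orient c z x * (y 0 - c 0) +
      orient c x y * (z 0 - c 0) = 0 := by unfold orient; ring
  have h1 : orient c y z * (x 1 - c 1) + orient c z x * (y 1 - c 1) +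
      orient c x y * (z 1 - c 1) = 0 := by unfold orient; ring
  set p := orient c y z
  set q := orient c z x
  set s := orient x y z
  have hs : orient c x y = s - p - q := by linarith
  rw [hs] at h0 h1
  set x0 := x 0 - c 0
  set x1 := x 1 - c 1
  set y0 := y 0 - c 0
  set y1 := y 1 - c 1
  set z0 := z 0 - c 0
  set z1 := z 1 - c 1
  have hs2 : 0 < s ^ 2 := by positivity
  have hpq : 0 ≤ p * q := by
    have : 0 ≤ s ^ 2 * (p * q) := by nlinarith [mul_nonneg_of_nonpos_of_nonpos hp hq]
    exact nonneg_of_mul_nonneg_right this hs2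
  have hxy : x0 * y0 + x1 * y1 ≤ r ^ 2 := by nlinarith [sq_nonneg (x0 - y0), sq_nonneg (x1 - y1)]
  have key : (s - p - q) ^ 2 * r ^ 2 =
      p ^ 2 * r ^ 2 + q ^ 2 * r ^ 2 + 2 * (p * q) * (x0 * y0 + x1 * y1) := by
    have e0 : (s - p - q) * z0 = -(p * x0 + q * y0) := by linarith
    have e1 : (s - p - q) * z1 = -(p * x1 + q * y1) := by linarith
    calc (s - p - q) ^ 2 * r ^ 2 = ((s - p - q) * z0) ^ 2 + ((s - p - q) * z1) ^ 2 := by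
          rw [← hz]; ring
      _ = p ^ 2 * (x0 ^ 2 + x1 ^ 2) + q ^ 2 * (y0 ^ 2 + y1 ^ 2) +
          2 * (p * q) * (x0 * y0 + x1 * y1) := by rw [e0, e1]; ring
      _ = _ := by rw [hx, hy]
  -- The triangle inequality on the circle gives `|s - p - q| ≤ |p + q|`, whereas `p` and `q` weakly
  -- oppose `s ≠ 0`, so `|s - p - q| = |s| + |p + q|`.
  have hle : (s - p - q) ^ 2 * r ^ 2 ≤ (p + q) ^ 2 * r ^ 2 := by
    nlinarith [mul_le_mul_of_nonneg_left hxy hpq]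
  have hle' := le_of_mul_le_mul_right hle (by positivity)
  nlinarith

end Polygon

/-! ### Sharpness for black points on a regular polygon -/

theorem orient_mul_orient_nonneg {S : Set Plane} {w c A B : Plane} (h : NotSeparatedFrom S w c)
    (hA : A ∈ S) (hB : B ∈ S) (hAB : A ≠ B) : 0 ≤ orient w A B * orient c A B := by
  by_contra! hlt
  exact h _ ⟨A, hA, B, hB, hAB, rfl⟩ ((separates_line_iff hAB w c).2 hlt)

namespace RectilinearDrawing

variable {n : ℕ} (R : RectilinearDrawing (starGraph n)) {c : Plane} {r θ : ℝ}

theorem exists_black_eq_polygonVertex (hb : R.blackPoints = regularPolygon n c r θ) :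
    ∃ e : Fin n → Fin n, Function.Injective e ∧
      ∀ i, R.black i = polygonVertex n c r θ (e i) := by
  have h : ∀ i, ∃ k, polygonVertex n c r θ k = R.black i := fun i => by
    have : R.black i ∈ regularPolygon n c r θ := hb ▸ ⟨i, rfl⟩
    exact this
  choose e he using h
  refine ⟨e, fun i j hij => R.black_injective ?_, fun i => (he i).symm⟩
  rw [← he, ← he, hij]

theorem eight_mul_crossingNumber_eq (hr : 0 < r)
    (hb : R.blackPoints = regularPolygon n c r θ)
    (hw : NotSeparatedFrom (regularPolygon n c r θ) R.whitePoint c) :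
    8 * (R.crossingNumber : ℤ) =
      (n : ℤ) * ((n : ℤ) - 1) * ((n : ℤ) - 3) + (if Even n then (n : ℤ) else 0) := by
  classical
  obtain ⟨e, he, hbe⟩ := R.exists_black_eq_polygonVertex hb
  -- Only weak agreement of signs: for even `n` the center lies on the diameters, where its
  -- orientation vanishes.
  have hside : ∀ i j, i ≠ j →
      0 ≤ R.tournament i j * orient c (R.black i) (R.black j) := fun i j hij =>
    orient_mul_orient_nonneg hw (hb ▸ ⟨i, rfl⟩) (hb ▸ ⟨j, rfl⟩) (R.black_injective.ne hij)
  have hsin : ∀ i j, orient c (R.black i) (R.black j) =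
      r ^ 2 * Real.sin (2 * Real.pi * ((e j : ℝ) - e i) / n) := fun i j => by
    rw [hbe, hbe, orient_center_polygonVertex]
  have hgap : ∀ i j, 0 < R.tournament i j →
      0 < cyclicGap (e i) (e j) ∧ 2 * cyclicGap (e i) (e j) ≤ n := by
    intro i j hij
    have hne : i ≠ j := by
      rintro rfl
      have := R.tournament_antisymm i i
      linarith
    refine ⟨cyclicGap_pos (he.ne hne), two_mul_cyclicGap_le ?_⟩
    have h1 := nonneg_of_mul_nonneg_right (hside i j hne) hij
    rw [hsin] at h1
    exact nonneg_of_mul_nonneg_right h1 (by positivity)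
  have hfar : ∀ i j k, R.tournament j k *
      (R.tournament j k + R.tournament k i + R.tournament i j) < 0 → j ≠ k →
      orient c (R.black j) (R.black k) * orient (R.black i) (R.black j) (R.black k) ≤ 0 := by
    intro i j k h hjk
    have h1 := hside j k hjk
    rw [orient_eq_add R.whitePoint (R.black i)]
    simp only [tournament] at h h1
    rcases mul_neg_iff.1 h with ⟨h2, h3⟩ | ⟨h2, h3⟩
    · exact mul_nonpos_of_nonneg_of_nonpos (nonneg_of_mul_nonneg_right h1 h2) h3.le
    · exact mul_nonpos_of_nonpos_of_nonneg (nonpos_of_mul_nonneg_right h1 h2) h3.le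
  have h := four_mul_oppositeTriples_eq R.tournament_antisymm
    (fun _ _ => R.orient_whitePoint_ne_zero) R.tournament_sum_ne_zero ?_ ?_
  · rw [← two_mul_crossingNumber, Fintype.card_fin] at h
    push_cast at h ⊢
    linarith
  -- Two opposing entries would place `c` weakly in the cone opposite to the triangle at `b k`.
  · rintro i j k h1 h2 h3 ⟨hp, hq⟩
    have hq' := hfar j k i (by
      rw [show R.tournament k i + R.tournament i j + R.tournament j k =
        R.tournament j k + R.tournament k i + R.tournament i j by ring]; exact hq) h3
    rw [← orient_rotate (R.black i) (R.black j)] at hq'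
    have hcirc : ∀ i, (R.black i 0 - c 0) ^ 2 + (R.black i 1 - c 1) ^ 2 = r ^ 2 := fun i => by
      rw [hbe]
      exact sq_add_sq_polygonVertex n c r θ (e i)
    exact not_center_opposite hr (hcirc i) (hcirc j) (hcirc k)
      (R.orient_black_ne_zero h1 h2 h3.symm) (hfar i j k hp h2) hq'
  · intro i
    have hout : 2 * outDegree R.tournament i ≤ n :=
      two_mul_card_le_of_gap ((cyclicGap_right_injective (e i)).comp he) fun j hj =>
        hgap i j (Finset.mem_filter.1 hj).2
    have hin : 2 * (Finset.univ.filter fun j => 0 < R.tournament j i).card ≤ n :=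
      two_mul_card_le_of_gap ((cyclicGap_left_injective (e i)).comp he) fun j hj =>
        hgap j i (Finset.mem_filter.1 hj).2
    -- In- and out-neighbours exhaust the other `n - 1` vertices; as each kind numbers at most `n /
    -- 2`, the upper bound on the in-degree bounds the out-degree from below.
    have hcover : (Finset.univ : Finset (Fin n)) ⊆
        (insert i (Finset.univ.filter fun j => 0 < R.tournament i j)) ∪
          Finset.univ.filter fun j => 0 < R.tournament j i := by
      intro j _
      by_cases hij : j = i
      · simp [hij]
      · have hanti := R.tournament_antisymm i j
        rcases (R.orient_whitePoint_ne_zero hij).lt_or_gt with h | h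
        · have : 0 < R.tournament i j := by
            rw [hanti]
            exact neg_pos.2 h
          simp [this]
        · have : 0 < R.tournament j i := h
          simp [this]
    have h1 := (Finset.card_le_card hcover).trans (Finset.card_union_le _ _)
    have h2 := Finset.card_insert_le i (Finset.univ.filter fun j => 0 < R.tournament i j)
    rw [Finset.card_univ, Fintype.card_fin] at h1
    rw [Fintype.card_fin]
    have h3 : outDegree R.tournament i =
      (Finset.univ.filter fun j => 0 < R.tournament i j).card := by
        unfold outDegree; congr
    omega

end RectilinearDrawing

/-! ### Existence of the polygon drawings -/

theorem not_collinear_polygonVertex {n : ℕ} (c : Plane) {r : ℝ} (θ : ℝ) (hr : 0 < r)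
    {i j k : Fin n} (h1 : i ≠ j) (h2 : i ≠ k) (h3 : j ≠ k) :
    ¬ Collinear ℝ {polygonVertex n c r θ i, polygonVertex n c r θ j, polygonVertex n c r θ k} := by
  rw [← affineIndependent_iff_not_collinear_set]
  have hinj := polygonVertex_injective (n := n) c θ hr
  have hcosph : EuclideanGeometry.Cospherical (Set.range (polygonVertex n c r θ)) := by
    refine ⟨c, r, ?_⟩
    rintro _ ⟨l, rfl⟩
    rw [EuclideanSpace.dist_eq, Fin.sum_univ_two, Real.dist_eq, Real.dist_eq, sq_abs, sq_abs,
      sq_add_sq_polygonVertex, Real.sqrt_sq hr.le]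
  exact hcosph.affineIndependent_of_mem_of_ne ⟨i, rfl⟩ ⟨j, rfl⟩ ⟨k, rfl⟩ (hinj.ne h1) (hinj.ne h2)
    (hinj.ne h3)

theorem exists_drawing_polygon {n : ℕ} {c w : Plane} {r θ : ℝ} (hr : 0 < r)
    (hw : ∀ i, polygonVertex n c r θ i ≠ w)
    (hline : ∀ i j, i ≠ j → orient w (polygonVertex n c r θ i) (polygonVertex n c r θ j) ≠ 0) :
    ∃ R : RectilinearDrawing (starGraph n),
      R.blackPoints = regularPolygon n c r θ ∧ R.whitePoint = w := by
  have hinj := polygonVertex_injective (n := n) c θ hr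
  have hcol : ∀ i j, i ≠ j →
      ¬ Collinear ℝ {w, polygonVertex n c r θ i, polygonVertex n c r θ j} := fun i j hij => by
    rw [collinear_iff_orient (hinj.ne hij)]
    exact hline i j hij
  refine ⟨⟨Sum.elim (polygonVertex n c r θ) fun _ => w, ?_, ?_⟩, rfl, rfl⟩
  · exact hinj.sumElim (Function.injective_of_subsingleton _) fun i _ => hw i
  · rintro _ ⟨u, rfl⟩ _ ⟨v, rfl⟩ _ ⟨x, rfl⟩ h1 h2 h3
    rcases u with u | u <;> rcases v with v | v <;> rcases x with x | x <;>
      simp only [Sum.elim_inl, Sum.elim_inr, ne_eq, not_true_eq_false] at h1 h2 h3 ⊢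
    · exact not_collinear_polygonVertex c θ hr (fun h => h1 (by rw [h])) (fun h => h2 (by rw [h]))
        (fun h => h3 (by rw [h]))
    · rw [Set.pair_comm, Set.insert_comm]
      exact hcol u v fun h => h1 (by rw [h])
    · rw [Set.insert_comm]
      exact hcol u x fun h => h2 (by rw [h])
    · exact hcol v x fun h => h3 (by rw [h])

theorem ae_orient_ne_zero {A B : Plane} (h : A ≠ B) :
    ∀ᵐ P : Plane, orient P A B ≠ 0 := by
  have hnull := MeasureTheory.Measure.addHaar_affineSubspace
    (MeasureTheory.volume : MeasureTheory.Measure Plane) line[ℝ, A, B] ?_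
  · filter_upwards [MeasureTheory.compl_mem_ae_iff.2 hnull] with P hP
    rwa [Set.mem_compl_iff, SetLike.mem_coe, mem_line_iff_orient h] at hP
  · intro htop
    have hmem : ∀ P : Plane, orient P A B = 0 := fun P => by
      rw [← mem_line_iff_orient h, htop]
      trivial
    -- This point is `A` plus `B - A` turned by a right angle; its orientation is the squared length
    -- of `B - A`.
    have h1 := hmem !₂[A 0 - (B 1 - A 1), A 1 + (B 0 - A 0)]
    simp only [orient, Matrix.cons_val_zero, Matrix.cons_val_one,
      Matrix.cons_val_fin_one] at h1
    have h2 : (B 0 - A 0) ^ 2 + (B 1 - A 1) ^ 2 = 0 := by linarith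
    refine h (PiLp.ext fun i => ?_)
    fin_cases i
    · show A 0 = B 0
      nlinarith
    · show A 1 = B 1
      nlinarith

/-- Generic points have full measure, hence are dense, so one lies in the neighbourhood of `c` that
stays strictly on the side of `c` for every line missing `c`. Lines through `c` separate nothing
from it. -/
theorem exists_generic_point_near_center {n : ℕ} {c : Plane} {r θ : ℝ} (hr : 0 < r) :
    ∃ w : Plane, (∀ i, polygonVertex n c r θ i ≠ w) ∧
      (∀ i j, i ≠ j → orient w (polygonVertex n c r θ i) (polygonVertex n c r θ j) ≠ 0) ∧
      NotSeparatedFrom (regularPolygon n c r θ) w c := by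
  have hinj := polygonVertex_injective (n := n) c θ hr
  set g := polygonVertex n c r θ
  have hae : ∀ᵐ w : Plane, (∀ i, g i ≠ w) ∧ ∀ i j, i ≠ j → orient w (g i) (g j) ≠ 0 := by
    refine Filter.Eventually.and ?_ ?_
    · rw [MeasureTheory.ae_all_iff]
      intro i
      filter_upwards [MeasureTheory.compl_mem_ae_iff.2
        (MeasureTheory.measure_singleton (μ := MeasureTheory.volume) (g i))] with w hw
      exact fun h => hw h.symm
    · rw [MeasureTheory.ae_all_iff]
      intro i
      rw [MeasureTheory.ae_all_iff]
      intro j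
      by_cases hij : i = j
      · simp [hij]
      · filter_upwards [ae_orient_ne_zero (hinj.ne hij)] with w hw _ using hw
  have hnear : ∀ᶠ w in nhds c, ∀ i j, orient c (g i) (g j) ≠ 0 →
      0 < orient w (g i) (g j) * orient c (g i) (g j) := by
    rw [Filter.eventually_all]
    intro i
    rw [Filter.eventually_all]
    intro j
    by_cases h0 : orient c (g i) (g j) = 0
    · simp [h0]
    · have hpos : 0 < orient c (g i) (g j) * orient c (g i) (g j) :=
        mul_self_pos.2 h0
      have hcont : Continuous fun w => orient w (g i) (g j) * orient c (g i) (g j) :=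
        (continuous_orient _ _).mul continuous_const
      filter_upwards [hcont.continuousAt.eventually (lt_mem_nhds hpos)] with w hw _ using hw
  obtain ⟨w, hw1, hw2⟩ := (MeasureTheory.Measure.dense_of_ae hae).inter_nhds_nonempty hnear
  refine ⟨w, hw1.1, hw1.2, ?_⟩
  rintro L ⟨_, ⟨i, rfl⟩, _, ⟨j, rfl⟩, hij, rfl⟩ hs
  have hlt := (separates_line_iff hij w c).1 hs
  have := hw2 i j (right_ne_zero_of_mul hlt.ne)
  exact lt_asymm hlt this

theorem exists_optimal_drawing (n : ℕ) (c : Plane) {r : ℝ} (θ : ℝ) (hr : 0 < r) :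
    ∃ R : RectilinearDrawing (starGraph n), R.blackPoints = regularPolygon n c r θ ∧
      NotSeparatedFrom (regularPolygon n c r θ) R.whitePoint c := by
  obtain ⟨w, h1, h2, h3⟩ := exists_generic_point_near_center (n := n) (c := c) (θ := θ) hr
  obtain ⟨R, hb, hw⟩ := exists_drawing_polygon hr h1 h2
  exact ⟨R, hb, by rwa [hw]⟩

/-! ### The minimum and its attainment -/

theorem eight_mul_orchardCrossingNumber (n : ℕ) :
    8 * (orchardCrossingNumber (starGraph n) : ℤ) =
      (n : ℤ) * ((n : ℤ) - 1) * ((n : ℤ) - 3) + (if Even n then (n : ℤ) else 0) := by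
  obtain ⟨R, hb, hw⟩ := exists_optimal_drawing n 0 0 one_pos
  have hR := R.eight_mul_crossingNumber_eq one_pos hb hw
  have hle : orchardCrossingNumber (starGraph n) ≤ R.crossingNumber := Nat.sInf_le ⟨R, rfl⟩
  obtain ⟨R', hR'⟩ := Nat.sInf_mem (⟨_, R, rfl⟩ : (Set.range fun R : RectilinearDrawing
    (starGraph n) => R.crossingNumber).Nonempty)
  have hge := R'.eight_mul_crossingNumber_ge
  have : orchardCrossingNumber (starGraph n) = R'.crossingNumber := hR'.symm
  omega

theorem notSeparatedFrom_self (S : Set Plane) (c : Plane) : NotSeparatedFrom S c c :=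
  fun _ _ h => h.2.2 rfl

theorem RectilinearDrawing.crossingNumber_eq_orchardCrossingNumber {n : ℕ}
    (R : RectilinearDrawing (starGraph n)) {c : Plane} {r θ : ℝ} (hr : 0 < r)
    (hb : R.blackPoints = regularPolygon n c r θ)
    (hw : NotSeparatedFrom (regularPolygon n c r θ) R.whitePoint c) :
    R.crossingNumber = orchardCrossingNumber (starGraph n) := by
  have h1 := R.eight_mul_crossingNumber_eq hr hb hw
  have h2 := eight_mul_orchardCrossingNumber n
  omega

theorem mainTheorem3 (n : ℕ) (hn : 1 ≤ n) :
    (Odd n →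
      (orchardCrossingNumber (starGraph n) : ℝ) = (n : ℝ) * ((n : ℝ) - 1) * ((n : ℝ) - 3) / 8 ∧
      ∀ (c : Plane) (r θ : ℝ), 0 < r →
        (∃ R : RectilinearDrawing (starGraph n),
          R.blackPoints = regularPolygon n c r θ ∧ R.whitePoint = c) ∧
        (∀ R : RectilinearDrawing (starGraph n),
          R.blackPoints = regularPolygon n c r θ → R.whitePoint = c →
            R.crossingNumber = orchardCrossingNumber (starGraph n))) ∧
    (Even n →
      (orchardCrossingNumber (starGraph n) : ℝ) = (n : ℝ) * ((n : ℝ) - 2) ^ 2 / 8 ∧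
      ∀ (c : Plane) (r θ : ℝ), 0 < r →
        (∃ R : RectilinearDrawing (starGraph n),
          R.blackPoints = regularPolygon n c r θ ∧
            NotSeparatedFrom (regularPolygon n c r θ) R.whitePoint c) ∧
        (∀ R : RectilinearDrawing (starGraph n),
          R.blackPoints = regularPolygon n c r θ →
            NotSeparatedFrom (regularPolygon n c r θ) R.whitePoint c →
            R.crossingNumber = orchardCrossingNumber (starGraph n))) := by
  have hval : 8 * (orchardCrossingNumber (starGraph n) : ℝ) =
      (n : ℝ) * ((n : ℝ) - 1) * ((n : ℝ) - 3) + (if Even n then (n : ℝ) else 0) := by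
    have := eight_mul_orchardCrossingNumber n
    have h := congrArg (Int.cast : ℤ → ℝ) this
    push_cast at h
    exact h
  refine ⟨fun hodd => ⟨?_, fun c r θ hr => ⟨?_, fun R hb hw => ?_⟩⟩,
    fun heven => ⟨?_, fun c r θ hr => ⟨exists_optimal_drawing n c θ hr, fun R hb hw =>
      R.crossingNumber_eq_orchardCrossingNumber hr hb hw⟩⟩⟩
  · rw [if_neg (Nat.not_even_iff_odd.2 hodd)] at hval
    linarith
  · refine exists_drawing_polygon hr (polygonVertex_ne_center n c θ hr) fun i j hij => ?_
    rw [orient_center_polygonVertex]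
    exact mul_ne_zero (by positivity) (sin_ne_zero_of_odd hodd hij)
  -- The odd case is the same criterion with the white point equal to `c`, since no line separates a
  -- point from itself.
  · exact R.crossingNumber_eq_orchardCrossingNumber hr hb (hw ▸ notSeparatedFrom_self _ _)
  · rw [if_pos heven] at hval
    linear_combination hval / 8
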